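/- Let $q$ be a prime power. An abstract unital of order $q$ is a $2$-$(q^3+1,q+1,1)$ design $U=(X,B)$; it is embedded in $\mathsf{PG}(2,q^2)$ if $X$ consists of points of $\mathsf{PG}(2,q^2)$ and each block $b\in B$ has the form $b=X\cap\ell$ for some line $\ell$ of $\mathsf{PG}(2,q^2)$. Blocks $b_1,b_2,b_3\in B$ form an embedded dual $3$-net in $U$ if they are pairwise disjoint and, for all $1\le i<j\le 3$, $P\in b_i$ and $Q\in b_j$, the block containing $P$ and $Q$ intersects each of $b_1,b_2,b_3$ in a point. A Baer subline of a line $\ell$ of $\mathsf{PG}(2,q^2)$ is a set of $q+1$ points of $\ell$ that are all self-conjugate with respect to some Hermitian polarity of $\mathsf{PG}(2,q^2)$. Let $U=(X,B)$ be an abstract unital of order $q$ embedded in $\mathsf{PG}(2,q^2)$, and let the blocks $b_1,b_2,b_3$ form an embedded dual $3$-net in $U$. Then, for each $i\in\{1,2,3\}$, $b_i$ is a Baer subline of the line $\ell_i$ of $\mathsf{PG}(2,q^2)$ with $b_i=X\cap\ell_i$. -/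

import Mathlib

open scoped LinearAlgebra.Projectivization

/-- `(X, B)` is a `2`-`(v, k, lam)` design: a set `X` of `v` points and
a set `B` of `k`-subsets of `X` (the blocks) such that any two distinct points of `X` are contained
in exactly `lam` blocks. -/
structure IsTwoDesign {P : Type*} (v k lam : ℕ) (X : Set P) (B : Set (Set P)) : Prop where
  encard_points : X.encard = v
  block_subset : ∀ b ∈ B, b ⊆ X
  encard_block : ∀ b ∈ B, b.encard = k
  encard_blocks_through : ∀ x ∈ X, ∀ y ∈ X, x ≠ y → {b ∈ B | x ∈ b ∧ y ∈ b}.encard = lam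

/-- An abstract unital of order `n`: a `2`-`(n^3 + 1, n + 1, 1)` design. -/
def IsAbstractUnital {P : Type*} (n : ℕ) (X : Set P) (B : Set (Set P)) : Prop :=
  IsTwoDesign (n ^ 3 + 1) (n + 1) 1 X B

/-- The blocks `b 0, …, b (k - 1)` form an embedded dual `k`-net in the unital with block set `B`:
they are pairwise disjoint, and any block joining a point of one of them to a point of another one
meets each of `b 0, …, b (k - 1)` in exactly one point. -/
structure IsEmbeddedDualNet {P : Type*} {k : ℕ} (B : Set (Set P)) (b : Fin k → Set P) : Prop where
  three_le : 3 ≤ k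
  mem_blocks : ∀ i, b i ∈ B
  disjoint : ∀ i j, i < j → Disjoint (b i) (b j)
  meets : ∀ i j, i < j → ∀ x ∈ b i, ∀ y ∈ b j, ∀ c ∈ B, x ∈ c → y ∈ c →
    ∀ m, ∃! z, z ∈ c ∩ b m

/-- A set of points of the plane `PG(2, K)` is a line if it is the set of points of a
two-dimensional subspace of `K^3`. -/
def IsProjLine {K : Type*} [Field K] (l : Set (ℙ K (Fin 3 → K))) : Prop :=
  ∃ W : Submodule K (Fin 3 → K), Module.finrank K W = 2 ∧ l = {p | p ∈ W.projectivization}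

/-- The incidence structure `(X, B)`, whose points are points of `PG(2, K)`, is embedded in
`PG(2, K)`: each block is the intersection of `X` with a line. -/
def IsEmbeddedInPlane {K : Type*} [Field K] (X : Set (ℙ K (Fin 3 → K)))
    (B : Set (Set (ℙ K (Fin 3 → K)))) : Prop :=
  ∀ b ∈ B, ∃ l, IsProjLine l ∧ b = X ∩ l

/-- The sesquilinear form `∑ i j, w i * H i j * (v j) ^ q` with matrix `H` on `K^3`, where `K` is a
field with `q ^ 2` elements, whose involutory automorphism is `x ↦ x ^ q`. -/
def sesqForm {K : Type*} [Field K] (q : ℕ) (H : Matrix (Fin 3) (Fin 3) K)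
    (w v : Fin 3 → K) : K :=
  ∑ i, ∑ j, w i * H i j * v j ^ q

/-- `ρ` is a Hermitian polarity of `PG(2, K)`, for `K` a field with `q ^ 2` elements: it maps each
point to its orthogonal line with respect to a nondegenerate Hermitian form. -/
def IsHermitianPolarity {K : Type*} [Field K] (q : ℕ)
    (ρ : ℙ K (Fin 3 → K) → Set (ℙ K (Fin 3 → K))) : Prop :=
  ∃ H : Matrix (Fin 3) (Fin 3) K, (∀ i j, H j i = H i j ^ q) ∧ H.det ≠ 0 ∧
    ∀ (v : Fin 3 → K) (hv : v ≠ 0) (w : Fin 3 → K) (hw : w ≠ 0),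
      Projectivization.mk K w hw ∈ ρ (Projectivization.mk K v hv) ↔ sesqForm q H w v = 0

/-- `s` is a Baer subline of the line `l` of `PG(2, K)`, for `K` a field with `q ^ 2` elements:
a set of `q + 1` points of `l` consisting of self-conjugate points of some Hermitian polarity. -/
def IsBaerSubline {K : Type*} [Field K] (q : ℕ) (l s : Set (ℙ K (Fin 3 → K))) : Prop :=
  IsProjLine l ∧ s ⊆ l ∧ s.encard = q + 1 ∧ ∃ ρ, IsHermitianPolarity q ρ ∧ ∀ p ∈ s, p ∈ ρ p

open Matrix

/-! Use linear forms defining the three lines as coordinates. If the lines form a triangle, points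
with suitable coordinate ratios `a`, `b`, `c` are collinear iff `a * b = c`, so every `b` from the
second block maps the `q + 1` values `a` onto the same set of values `c`. Comparing products
(`pow_card_eq_of_mul_mem`) shows that `b ^ (q + 1)` is constant, which is the equation of a
Hermitian curve restricted to that line. If the lines are concurrent, collinearity becomes `a + b =
c`; comparing sums (`card_nsmul_eq_of_add_mem`) makes `(q + 1) • b = b` constant, so the block has
only one point, a contradiction. Both cases are in `exists_isHermitianPolarity_of_collinear`. -/

/-- If `b` and `b'` multiply `A` into a set `C` that is no larger than `A`, then their powers of
exponent `A.card` agree. -/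
theorem pow_card_eq_of_mul_mem {K : Type*} [Field K] {A C : Finset K}
    (hA : ∀ a ∈ A, a ≠ 0) (hCA : C.card ≤ A.card) {b b' : K} (hb : b ≠ 0) (hb' : b' ≠ 0)
    (h : ∀ a ∈ A, a * b ∈ C) (h' : ∀ a ∈ A, a * b' ∈ C) : b ^ A.card = b' ^ A.card := by
  classical
  have key : ∀ x : K, x ≠ 0 → (∀ a ∈ A, a * x ∈ C) → (∏ a ∈ A, a) * x ^ A.card = ∏ c ∈ C, c := by
    intro x hx hxC
    have hinj : Set.InjOn (fun a => a * x) A := fun a _ a' _ e => mul_right_cancel₀ hx e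
    have himg : A.image (fun a => a * x) = C := by
      apply Finset.eq_of_subset_of_card_le
      · intro c hc
        obtain ⟨a, ha, rfl⟩ := Finset.mem_image.1 hc
        exact hxC a ha
      · rwa [Finset.card_image_of_injOn hinj]
    rw [← himg, Finset.prod_image hinj, Finset.prod_mul_distrib, Finset.prod_const]
  exact mul_left_cancel₀ (Finset.prod_ne_zero_iff.2 hA) ((key b hb h).trans (key b' hb' h').symm)

/-- The additive analogue of `pow_card_eq_of_mul_mem`. -/
theorem card_nsmul_eq_of_add_mem {G : Type*} [AddCommGroup G] {A C : Finset G}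
    (hCA : C.card ≤ A.card) {b b' : G}
    (h : ∀ a ∈ A, a + b ∈ C) (h' : ∀ a ∈ A, a + b' ∈ C) : A.card • b = A.card • b' := by
  classical
  have key : ∀ x : G, (∀ a ∈ A, a + x ∈ C) → (∑ a ∈ A, a) + A.card • x = ∑ c ∈ C, c := by
    intro x hxC
    have hinj : Set.InjOn (fun a => a + x) A := fun a _ a' _ e => add_right_cancel e
    have himg : A.image (fun a => a + x) = C := by
      apply Finset.eq_of_subset_of_card_le
      · intro c hc
        obtain ⟨a, ha, rfl⟩ := Finset.mem_image.1 hc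
        exact hxC a ha
      · rwa [Finset.card_image_of_injOn hinj]
    rw [← himg, Finset.sum_image hinj, Finset.sum_add_distrib, Finset.sum_const]
  exact add_left_cancel ((key b h).trans (key b' h').symm)

/-! ### The field with `q ^ 2` elements -/

/-- In a field with `q ^ 2` elements, `x ↦ x ^ q` is a ring endomorphism. -/
theorem exists_ringHom_eq_pow {K : Type*} [Field K] [Fintype K] {q : ℕ}
    (hK : Fintype.card K = q ^ 2) : ∃ σ : K →+* K, ∀ x, σ x = x ^ q := by
  obtain ⟨p, hp⟩ := CharP.exists K
  obtain ⟨n, hprime, hn⟩ := FiniteField.card K p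
  have : Fact p.Prime := ⟨hprime⟩
  obtain ⟨m, -, rfl⟩ := (Nat.dvd_prime_pow hprime).1
    (show q ∣ p ^ (n : ℕ) from hn ▸ hK ▸ Dvd.intro_left _ (by ring : q * q = q ^ 2))
  exact ⟨iterateFrobenius K p m, fun x => iterateFrobenius_def p m x⟩

/-- In a field with `q ^ 2` elements, `q` vanishes. -/
theorem cast_eq_zero_of_card_eq_sq {K : Type*} [Field K] [Fintype K] {q : ℕ}
    (hK : Fintype.card K = q ^ 2) : (q : K) = 0 := by
  have h := Nat.cast_card_eq_zero K
  rw [hK, Nat.cast_pow] at h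
  exact pow_eq_zero_iff two_ne_zero |>.1 h

/-! ### Coordinates on the plane -/

/-- A projective line is the zero set of a nonzero linear form. -/
theorem IsProjLine.exists_dotProduct {K : Type*} [Field K] {l : Set (ℙ K (Fin 3 → K))}
    (hl : IsProjLine l) : ∃ m : Fin 3 → K, m ≠ 0 ∧ ∀ p, p ∈ l ↔ m ⬝ᵥ p.rep = 0 := by
  obtain ⟨W, hW, rfl⟩ := hl
  have hlt : W < ⊤ := by
    refine lt_top_iff_ne_top.2 ?_
    rintro rfl
    simp at hW
  obtain ⟨f, hf, hWf⟩ := Submodule.exists_le_ker_of_lt_top W hlt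
  have hker : W = LinearMap.ker f := by
    apply Submodule.eq_of_le_of_finrank_le hWf
    have h1 := Submodule.finrank_lt (s := LinearMap.ker f)
      (lt_top_iff_ne_top.2 fun h => hf (LinearMap.ker_eq_top.1 h)).ne
    simp at h1
    omega
  have hfm : ∀ v, f v = (fun j => f (Pi.single j 1)) ⬝ᵥ v := by
    intro v
    conv_lhs => rw [pi_eq_sum_univ' v, map_sum]
    refine Finset.sum_congr rfl fun i _ => ?_
    rw [map_smul, smul_eq_mul, mul_comm]
  refine ⟨fun j => f (Pi.single j 1), ?_, fun p => ?_⟩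
  · intro h
    apply hf
    ext v
    simpa using congrFun h v
  · rw [← hfm, ← LinearMap.mem_ker, ← hker, Set.mem_ofPred_eq]
    conv_lhs => rw [← p.mk_rep]
    rfl

/-- Three collinear points have dependent coordinates in every triple of linear forms. -/
theorem det_eq_zero_of_collinear {K : Type*} [Field K] {h : Fin 3 → K} (h0 : h ≠ 0)
    (M V : Matrix (Fin 3) (Fin 3) K) (hV : ∀ i, h ⬝ᵥ V i = 0) :
    (Matrix.of fun i j => M j ⬝ᵥ V i).det = 0 := by
  have hdet : V.det = 0 := by
    rw [← Matrix.exists_mulVec_eq_zero_iff]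
    exact ⟨h, h0, funext fun i => (dotProduct_comm _ _).trans (hV i)⟩
  have : (Matrix.of fun i j => M j ⬝ᵥ V i) = V * Mᵀ := by
    ext i j
    simp [Matrix.mul_apply, dotProduct, mul_comm]
  rw [this, Matrix.det_mul, hdet, zero_mul]

/-- Points with proportional coordinate vectors are equal. -/
theorem eq_of_mulVec_rep_eq_smul {K : Type*} [Field K] {M : Matrix (Fin 3) (Fin 3) K}
    (hM : M.det ≠ 0) {p p' : ℙ K (Fin 3 → K)} {t : K}
    (h : ∀ i, M i ⬝ᵥ p.rep = t * M i ⬝ᵥ p'.rep) : p = p' := by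
  have hv : p.rep - t • p'.rep = 0 := by
    by_contra hne
    refine hM (Matrix.exists_mulVec_eq_zero_iff.1 ⟨_, hne, ?_⟩)
    ext i
    have := h i
    simp only [Matrix.mulVec, dotProduct_sub, dotProduct_smul, smul_eq_mul, Pi.zero_apply, this,
      sub_self]
  rw [← p.mk_rep, ← p'.mk_rep, Projectivization.mk_eq_mk_iff']
  exact ⟨t, (sub_eq_zero.1 hv).symm⟩

/-! ### Hermitian forms -/

theorem sesqForm_smul_smul {K : Type*} [Field K] (q : ℕ) (H : Matrix (Fin 3) (Fin 3) K) (a c : K)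
    (w v : Fin 3 → K) : sesqForm q H (a • w) (c • v) = a * c ^ q * sesqForm q H w v := by
  simp only [sesqForm, Finset.mul_sum, Pi.smul_apply, smul_eq_mul, mul_pow]
  exact Finset.sum_congr rfl fun i _ => Finset.sum_congr rfl fun j _ => by ring

/-- The points where a nondegenerate diagonal Hermitian form in the coordinates given by `M`
vanishes are self-conjugate for some Hermitian polarity. -/
theorem exists_isHermitianPolarity_of_diagonal {K : Type*} [Field K] [Fintype K] {q : ℕ}
    (hK : Fintype.card K = q ^ 2) {M : Matrix (Fin 3) (Fin 3) K} (hM : M.det ≠ 0)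
    {d : Fin 3 → K} (hd : ∀ k, d k ≠ 0) (hdq : ∀ k, d k ^ q = d k) :
    ∃ ρ, IsHermitianPolarity q ρ ∧ ∀ p : ℙ K (Fin 3 → K),
      ∑ k, d k * (M k ⬝ᵥ p.rep) ^ (q + 1) = 0 → p ∈ ρ p := by
  obtain ⟨σ, hσ⟩ := exists_ringHom_eq_pow hK
  have hσσ : ∀ x, σ (σ x) = x := fun x => by
    rw [hσ, hσ, ← pow_mul, ← sq, ← hK, FiniteField.pow_card]
  -- The diagonal form pulled back along the coordinate change `M`, with `σ` acting on the second
  -- argument.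
  set H : Matrix (Fin 3) (Fin 3) K := Mᵀ * Matrix.diagonal d * M.map σ with hH
  have hHa : ∀ i j, H i j = ∑ k, d k * M k i * σ (M k j) := by
    intro i j
    rw [hH, Matrix.mul_apply]
    refine Finset.sum_congr rfl fun k _ => ?_
    rw [Matrix.mul_diagonal, Matrix.map_apply, Matrix.transpose_apply, mul_comm (M k i)]
  have hsesq : ∀ v, sesqForm q H v v = ∑ k, d k * (M k ⬝ᵥ v) ^ (q + 1) := by
    intro v
    have : ∀ k, (M k ⬝ᵥ v) ^ (q + 1) = (∑ i, M k i * v i) * ∑ j, σ (M k j) * σ (v j) := by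
      intro k
      rw [pow_succ, ← hσ, dotProduct, map_sum, mul_comm]
      simp only [map_mul]
    simp only [this, sesqForm, hHa, ← hσ, Fin.sum_univ_three]
    ring
  refine ⟨fun p => {w | sesqForm q H w.rep p.rep = 0}, ⟨H, ?_, ?_, ?_⟩, ?_⟩
  · intro i j
    rw [← hσ, hHa, hHa, map_sum]
    refine Finset.sum_congr rfl fun k _ => ?_
    rw [map_mul, map_mul, hσσ, hσ (d k), hdq]
    ring
  · rw [hH, Matrix.det_mul, Matrix.det_mul, Matrix.det_transpose, Matrix.det_diagonal]
    have : (M.map σ).det = σ M.det := (RingHom.map_det σ M).symm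
    rw [this]
    exact mul_ne_zero (mul_ne_zero hM (Finset.prod_ne_zero_iff.2 fun k _ => hd k))
      ((map_ne_zero σ).2 hM)
  · intro v hv w hw
    obtain ⟨a, ha⟩ := Projectivization.exists_smul_eq_mk_rep K v hv
    obtain ⟨c, hc⟩ := Projectivization.exists_smul_eq_mk_rep K w hw
    rw [Set.mem_ofPred_eq, ← ha, ← hc, Units.smul_def, Units.smul_def, sesqForm_smul_smul]
    simp
  · intro p hp
    rw [Set.mem_ofPred_eq, hsesq, hp]

/-! ### Collinear triples on three lines -/

/-- Three sets, each on a line, none meeting the lines of the others, such that the line joining a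
point of the first to a point of the second meets the third: the second set is contained in the
self-conjugate points of a Hermitian polarity. -/
theorem exists_isHermitianPolarity_of_collinear {K : Type*} [Field K] [Fintype K] {q : ℕ}
    (hK : Fintype.card K = q ^ 2) (M : Matrix (Fin 3) (Fin 3) K)
    (S : Fin 3 → Set (ℙ K (Fin 3 → K))) (hcard : ∀ i, (S i).ncard = q + 1)
    (hS : ∀ i j, ∀ p ∈ S i, M j ⬝ᵥ p.rep = 0 ↔ j = i)
    (hcol : ∀ x ∈ S 0, ∀ y ∈ S 1, ∃ z ∈ S 2, ∃ h : Fin 3 → K, h ≠ 0 ∧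
      h ⬝ᵥ x.rep = 0 ∧ h ⬝ᵥ y.rep = 0 ∧ h ⬝ᵥ z.rep = 0) :
    ∃ ρ, IsHermitianPolarity q ρ ∧ ∀ p ∈ S 1, p ∈ ρ p := by
  classical
  have hfin : ∀ i, (S i).Finite := fun i => Set.finite_of_ncard_pos (by rw [hcard]; omega)
  have hcardF : ∀ i, (hfin i).toFinset.card = q + 1 := fun i => by
    rw [← Set.ncard_eq_toFinset_card, hcard]
  have hne : ∀ i, (S i).Nonempty := fun i =>
    Set.nonempty_of_ncard_ne_zero (by rw [hcard]; omega)
  have hdet : ∀ N : Matrix (Fin 3) (Fin 3) K, ∀ x ∈ S 0, ∀ y ∈ S 1, ∃ z ∈ S 2,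
      (Matrix.of fun i j => N j ⬝ᵥ (![x, y, z] i).rep).det = 0 := by
    intro N x hx y hy
    obtain ⟨z, hz, h, h0, h1, h2, h3⟩ := hcol x hx y hy
    refine ⟨z, hz, det_eq_zero_of_collinear h0 N (fun i => (![x, y, z] i).rep) ?_⟩
    intro i
    fin_cases i <;> assumption
  have z0 : ∀ p ∈ S 0, M 0 ⬝ᵥ p.rep = 0 ∧ M 1 ⬝ᵥ p.rep ≠ 0 ∧ M 2 ⬝ᵥ p.rep ≠ 0 := fun p hp =>
    ⟨(hS 0 0 p hp).2 rfl, mt (hS 0 1 p hp).1 (by decide), mt (hS 0 2 p hp).1 (by decide)⟩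
  have z1 : ∀ p ∈ S 1, M 0 ⬝ᵥ p.rep ≠ 0 ∧ M 1 ⬝ᵥ p.rep = 0 ∧ M 2 ⬝ᵥ p.rep ≠ 0 := fun p hp =>
    ⟨mt (hS 1 0 p hp).1 (by decide), (hS 1 1 p hp).2 rfl, mt (hS 1 2 p hp).1 (by decide)⟩
  have z2 : ∀ p ∈ S 2, M 0 ⬝ᵥ p.rep ≠ 0 ∧ M 1 ⬝ᵥ p.rep ≠ 0 ∧ M 2 ⬝ᵥ p.rep = 0 := fun p hp =>
    ⟨mt (hS 2 0 p hp).1 (by decide), mt (hS 2 1 p hp).1 (by decide), (hS 2 2 p hp).2 rfl⟩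
  -- Singular `M` means concurrent lines. The dependency `c` between the three forms has no zero
  -- entry.
  by_cases hM : M.det = 0
  · exfalso
    obtain ⟨c, hc0, hc⟩ := Matrix.exists_vecMul_eq_zero_iff.2 hM
    have hrel : ∀ v, c 0 * M 0 ⬝ᵥ v + c 1 * M 1 ⬝ᵥ v + c 2 * M 2 ⬝ᵥ v = 0 := by
      intro v
      have : (c ᵥ* M) ⬝ᵥ v = 0 := by rw [hc, zero_dotProduct]
      rw [← dotProduct_mulVec] at this
      simpa [dotProduct, Matrix.mulVec, Fin.sum_univ_three] using this
    obtain ⟨p0, hp0⟩ := hne 0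
    obtain ⟨p1, hp1⟩ := hne 1
    obtain ⟨a0, a1, a2⟩ := z0 p0 hp0
    obtain ⟨b0, b1, b2⟩ := z1 p1 hp1
    have ra := hrel p0.rep
    have rb := hrel p1.rep
    rw [a0] at ra
    rw [b1] at rb
    have hc2 : c 2 ≠ 0 := by
      intro h
      apply hc0
      ext i
      fin_cases i
      · simpa [h, b0] using rb
      · simpa [h, a1] using ra
      · exact h
    have hc0' : c 0 ≠ 0 := fun h => hc2 (by simpa [h, b2] using rb)
    have hc1 : c 1 ≠ 0 := fun h => hc2 (by simpa [h, a2] using ra)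
    have hcross : M 0 ⨯₃ M 1 ≠ 0 := by
      intro h
      have h2 : M 0 = 0 := by
        have e : ∀ i, (p0.rep ⨯₃ (M 0 ⨯₃ M 1)) i =
            (M 1 ⬝ᵥ p0.rep) * M 0 i - (M 0 ⬝ᵥ p0.rep) * M 1 i := by
          intro i
          fin_cases i <;> simp [cross_apply, dotProduct, Fin.sum_univ_three] <;> ring
        ext i
        have := e i
        rw [h, a0] at this
        simpa [a1] using this
      exact b0 (by rw [h2, zero_dotProduct])
    obtain ⟨k, hk⟩ := Function.ne_iff.1 hcross
    -- A coordinate functional completing `M 0`, `M 1` to a basis; the determinant is the chosen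
    -- nonzero entry of their cross product.
    set g : Fin 3 → K := Pi.single k 1 with hg
    set N : Matrix (Fin 3) (Fin 3) K := ![M 0, M 1, g] with hN
    have hNdet : N.det ≠ 0 := by
      have : N.det = (M 0 ⨯₃ M 1) k := by
        rw [Matrix.det_fin_three]
        fin_cases k <;> simp [hN, hg, cross_apply] <;> ring
      rwa [this]
    -- On the third line `c 0 * M 0 = -c 1 * M 1`, and this scaling turns collinearity of `x`, `y`,
    -- `z` into `α x + β y = β z`.
    let α : ℙ K (Fin 3 → K) → K := fun p => -c 0 * (g ⬝ᵥ p.rep) / (M 1 ⬝ᵥ p.rep)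
    let β : ℙ K (Fin 3 → K) → K := fun p => c 1 * (g ⬝ᵥ p.rep) / (M 0 ⬝ᵥ p.rep)
    have hαinj : Set.InjOn α (hfin 0).toFinset := by
      intro p hp p' hp' e
      obtain ⟨a0, a1, -⟩ := z0 p (by simpa using hp)
      obtain ⟨a0', a1', -⟩ := z0 p' (by simpa using hp')
      refine eq_of_mulVec_rep_eq_smul hNdet (t := M 1 ⬝ᵥ p.rep / M 1 ⬝ᵥ p'.rep) ?_
      intro i
      simp only [α] at e
      field_simp at e
      fin_cases i
      · simp [hN, a0, a0']
      · simp [hN, a1']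
      · simp only [hN]
        change g ⬝ᵥ p.rep = _ * g ⬝ᵥ p'.rep
        field_simp
        linear_combination -e
    have hβinj : Set.InjOn β (S 1) := by
      intro p hp p' hp' e
      obtain ⟨a0, a1, -⟩ := z1 p hp
      obtain ⟨a0', a1', -⟩ := z1 p' hp'
      refine eq_of_mulVec_rep_eq_smul hNdet (t := M 0 ⬝ᵥ p.rep / M 0 ⬝ᵥ p'.rep) ?_
      intro i
      simp only [β] at e
      field_simp at e
      fin_cases i
      · simp [hN, a0']
      · simp [hN, a1, a1']
      · simp only [hN]
        change g ⬝ᵥ p.rep = _ * g ⬝ᵥ p'.rep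
        field_simp
        linear_combination e
    have hmem : ∀ y ∈ S 1, ∀ a ∈ (hfin 0).toFinset.image α,
        a + β y ∈ (hfin 2).toFinset.image β := by
      intro y hy a ha
      obtain ⟨x, hx, rfl⟩ := Finset.mem_image.1 ha
      have hx' : x ∈ S 0 := by simpa using hx
      obtain ⟨z, hz, hdz⟩ := hdet N x hx' y hy
      refine Finset.mem_image.2 ⟨z, by simpa using hz, ?_⟩
      obtain ⟨x0, x1, -⟩ := z0 x hx'
      obtain ⟨y0, y1, -⟩ := z1 y hy
      obtain ⟨w0, w1, w2⟩ := z2 z hz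
      have rz := hrel z.rep
      rw [w2] at rz
      rw [Matrix.det_fin_three] at hdz
      simp [hN, x0, y1] at hdz
      simp only [α, β]
      field_simp
      linear_combination -c 1 * hdz + g ⬝ᵥ x.rep * M 0 ⬝ᵥ y.rep * rz
    have hAcard : ((hfin 0).toFinset.image α).card = q + 1 := by
      rw [Finset.card_image_of_injOn hαinj, hcardF]
    have hCcard : ((hfin 2).toFinset.image β).card ≤ ((hfin 0).toFinset.image α).card := by
      rw [hAcard, ← hcardF 2]
      exact Finset.card_image_le
    have hsub : (S 1).Subsingleton := by
      intro y hy y' hy'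
      apply hβinj hy hy'
      -- Since `q = 0` in `K`, multiplication by `q + 1` is the identity.
      have := card_nsmul_eq_of_add_mem hCcard (hmem y hy) (hmem y' hy')
      rw [hAcard] at this
      simpa [cast_eq_zero_of_card_eq_sq hK] using this
    have h1 := (Set.ncard_le_one (hfin 1)).2 fun a ha b hb => hsub ha hb
    rw [hcard] at h1
    have hq : q = 0 := by omega
    rw [hq] at hK
    simp at hK
  -- In the triangle case, collinearity reads `α x * β y = γ z` (Menelaus), which explains the sign
  -- in `γ`.
  · let α : ℙ K (Fin 3 → K) → K := fun p => M 2 ⬝ᵥ p.rep / M 1 ⬝ᵥ p.rep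
    let β : ℙ K (Fin 3 → K) → K := fun p => M 0 ⬝ᵥ p.rep / M 2 ⬝ᵥ p.rep
    let γ : ℙ K (Fin 3 → K) → K := fun p => - (M 0 ⬝ᵥ p.rep / M 1 ⬝ᵥ p.rep)
    have hαinj : Set.InjOn α (hfin 0).toFinset := by
      intro p hp p' hp' e
      obtain ⟨a0, a1, -⟩ := z0 p (by simpa using hp)
      obtain ⟨a0', a1', -⟩ := z0 p' (by simpa using hp')
      refine eq_of_mulVec_rep_eq_smul hM (t := M 1 ⬝ᵥ p.rep / M 1 ⬝ᵥ p'.rep) ?_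
      intro i
      simp only [α] at e
      field_simp at e
      fin_cases i
      · simp [a0, a0']
      · simp [a1']
      · change M 2 ⬝ᵥ p.rep = _ * M 2 ⬝ᵥ p'.rep
        field_simp
        linear_combination e
    have hβ0 : ∀ y ∈ S 1, β y ≠ 0 := fun y hy => div_ne_zero (z1 y hy).1 (z1 y hy).2.2
    have hmem : ∀ y ∈ S 1, ∀ a ∈ (hfin 0).toFinset.image α,
        a * β y ∈ (hfin 2).toFinset.image γ := by
      intro y hy a ha
      obtain ⟨x, hx, rfl⟩ := Finset.mem_image.1 ha
      have hx' : x ∈ S 0 := by simpa using hx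
      obtain ⟨z, hz, hdz⟩ := hdet M x hx' y hy
      refine Finset.mem_image.2 ⟨z, by simpa using hz, ?_⟩
      obtain ⟨x0, x1, -⟩ := z0 x hx'
      obtain ⟨y0, y1, y2⟩ := z1 y hy
      obtain ⟨w0, w1, w2⟩ := z2 z hz
      rw [Matrix.det_fin_three] at hdz
      simp [x0, y1, w2] at hdz
      simp only [α, β, γ]
      field_simp
      linear_combination -hdz
    have hA0 : ∀ a ∈ (hfin 0).toFinset.image α, a ≠ 0 := by
      intro a ha
      obtain ⟨x, hx, rfl⟩ := Finset.mem_image.1 ha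
      obtain ⟨-, h1, h2⟩ := z0 x (by simpa using hx)
      exact div_ne_zero h2 h1
    have hAcard : ((hfin 0).toFinset.image α).card = q + 1 := by
      rw [Finset.card_image_of_injOn hαinj, hcardF]
    have hCcard : ((hfin 2).toFinset.image γ).card ≤ ((hfin 0).toFinset.image α).card := by
      rw [hAcard, ← hcardF 2]
      exact Finset.card_image_le
    obtain ⟨y', hy'⟩ := hne 1
    obtain ⟨σ, hσ⟩ := exists_ringHom_eq_pow hK
    -- A norm to the subfield of order `q` is fixed by `x ↦ x ^ q`, so it may be a diagonal
    -- Hermitian coefficient.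
    have hdq : (β y' ^ (q + 1)) ^ q = β y' ^ (q + 1) := by
      rw [← pow_mul, show (q + 1) * q = q ^ 2 + q by ring, pow_add, ← hK, FiniteField.pow_card,
        pow_succ']
    obtain ⟨ρ, hρ, hself⟩ := exists_isHermitianPolarity_of_diagonal hK hM
      -- `M 1` vanishes on `S 1`, so the middle entry only serves nondegeneracy; the others encode
      -- that `β ^ (q + 1)` is constant.
      (d := ![1, 1, -(β y' ^ (q + 1))])
      (by
        intro k
        fin_cases k
        · exact one_ne_zero
        · exact one_ne_zero
        · exact neg_ne_zero.2 (pow_ne_zero _ (hβ0 y' hy')))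
      (by
        intro k
        fin_cases k
        · exact one_pow q
        · exact one_pow q
        · change (-(β y' ^ (q + 1))) ^ q = -(β y' ^ (q + 1))
          rw [← hσ, map_neg, hσ, hdq])
    refine ⟨ρ, hρ, fun y hy => hself y ?_⟩
    have hpow := pow_card_eq_of_mul_mem hA0 hCcard (hβ0 y hy) (hβ0 y' hy') (hmem y hy)
      (hmem y' hy')
    obtain ⟨y0, y1, y2⟩ := z1 y hy
    rw [hAcard] at hpow
    rw [← hpow]
    simp [Fin.sum_univ_three, y1, β, div_pow]
    field_simp
    ring

/-! ### Application to embedded unitals -/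

/-- If a unital of order `q` is embedded in the plane over a field with `q ^ 2` elements, then each
block of an embedded dual `3`-net of the unital is a Baer subline of the line that contains it. -/
theorem proposition4 {K : Type*} [Field K] [Fintype K] (q : ℕ) (hK : Fintype.card K = q ^ 2)
    (X : Set (ℙ K (Fin 3 → K))) (B : Set (Set (ℙ K (Fin 3 → K))))
    (hU : IsAbstractUnital q X B) (hE : IsEmbeddedInPlane X B)
    (b : Fin 3 → Set (ℙ K (Fin 3 → K))) (hb : IsEmbeddedDualNet B b) :
    ∀ i, ∃ l, IsProjLine l ∧ b i = X ∩ l ∧ IsBaerSubline q l (b i) := by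
  choose l hl hbl using fun i => hE (b i) (hb.mem_blocks i)
  choose m _ hml using fun i => (hl i).exists_dotProduct
  have hdisj : ∀ i j, i ≠ j → Disjoint (b i) (b j) := fun i j hij =>
    hij.lt_or_gt.elim (hb.disjoint i j) fun h => (hb.disjoint j i h).symm
  have hS : ∀ i j, ∀ p ∈ b i, m j ⬝ᵥ p.rep = 0 ↔ j = i := by
    intro i j p hp
    have hp' : p ∈ X ∩ l i := hbl i ▸ hp
    rw [← hml]
    refine ⟨fun h => ?_, fun h => h ▸ hp'.2⟩
    -- A point of `b i` on `l j` lies in `X ∩ l j = b j`, against disjointness.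
    by_contra hne
    exact Set.disjoint_left.1 (hdisj j i hne) (hbl j ▸ ⟨hp'.1, h⟩) hp
  have hmeets : ∀ i j, i ≠ j → ∀ x ∈ b i, ∀ y ∈ b j, ∀ c ∈ B, x ∈ c → y ∈ c →
      ∀ k, ∃ z, z ∈ c ∩ b k := by
    intro i j hij x hx y hy c hc hxc hyc k
    rcases hij.lt_or_gt with h | h
    · exact (hb.meets i j h x hx y hy c hc hxc hyc k).exists
    · exact (hb.meets j i h y hy x hx c hc hyc hxc k).exists
  have hcol : ∀ i j k, i ≠ j → ∀ x ∈ b i, ∀ y ∈ b j, ∃ z ∈ b k, ∃ h : Fin 3 → K, h ≠ 0 ∧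
      h ⬝ᵥ x.rep = 0 ∧ h ⬝ᵥ y.rep = 0 ∧ h ⬝ᵥ z.rep = 0 := by
    intro i j k hij x hx y hy
    have hxy : x ≠ y := fun e => Set.disjoint_left.1 (hdisj i j hij) hx (e ▸ hy)
    have hone := hU.encard_blocks_through x (hU.block_subset _ (hb.mem_blocks i) hx) y
      (hU.block_subset _ (hb.mem_blocks j) hy) hxy
    obtain ⟨c, hcB, hxc, hyc⟩ : {c ∈ B | x ∈ c ∧ y ∈ c}.Nonempty := by
      rw [← Set.encard_ne_zero, hone]
      simp
    obtain ⟨z, hzc, hz⟩ := hmeets i j hij x hx y hy c hcB hxc hyc k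
    obtain ⟨l', hl', rfl⟩ := hE c hcB
    obtain ⟨h, h0, hh⟩ := hl'.exists_dotProduct
    exact ⟨z, hz, h, h0, (hh x).1 hxc.2, (hh y).1 hyc.2, (hh z).1 hzc.2⟩
  intro i
  have hcard := fun i => hU.encard_block _ (hb.mem_blocks i)
  refine ⟨l i, hl i, hbl i, hl i, ?_, ?_, ?_⟩
  · exact (hbl i).subset.trans Set.inter_subset_right
  · rw [hcard]
    push_cast
    rfl
  -- The cyclic shift by `i - 1` puts `b i` at index `1`, the block covered by the lemma.
  · have := exists_isHermitianPolarity_of_collinear hK (fun k => m (k + (i - 1)))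
      (fun k => b (k + (i - 1)))
      (fun k => by rw [Set.ncard, hcard]; rfl)
      (fun s t p hp => (hS _ _ p hp).trans (add_left_inj _))
      (hcol _ _ _ (by simp))
    simpa using this
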